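/- Let $k$ be a field, and let $A=k[x_1,\dots,x_r]$ and $B=k[y_1,\dots,y_s]$ be standard graded polynomial rings over $k$ in disjoint finite sets of variables. Let $I\subset A$ and $J\subset B$ be nonzero proper homogeneous ideals, and let $I+J$ denote the sum of the ideals generated by $I$ and by $J$ in $R=A\otimes_k B=k[x_1,\dots,x_r,y_1,\dots,y_s]$. For an ideal $Q$ of a Noetherian ring $S$ and an integer $m\ge 1$, let $Q^{(m)}:=S\cap\bigcap_{P\in\operatorname{Min}(Q)}Q^mS_P$ be its $m$-th symbolic power, where $\operatorname{Min}(Q)$ is the set of minimal primes of $Q$ and the intersection with $S$ means the preimage under the localization maps $S\to S_P$. For a nonzero homogeneous ideal $Q$ of a standard graded polynomial ring over $k$, let $\alpha(Q):=\min\{d\mid Q_d\neq 0\}$ be the smallest degree of a nonzero homogeneous element of $Q$, and, if $Q$ is also proper, let its Waldschmidt constant be $\hat\alpha(Q):=\lim_{m\to\infty}\alpha(Q^{(m)})/m$. Then the limits defining $\hat\alpha(I)$, $\hat\alpha(J)$ and $\hat\alpha(I+J)$ exist, and $$\hat\alpha(I+J)=\min\{\hat\alpha(I),\hat\alpha(J)\}.$$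 -/

import Mathlib

open Filter Topology MvPolynomial

attribute [local instance] MvPolynomial.gradedAlgebra

noncomputable section

/-- The `n`-th symbolic power `Q⁽ⁿ⁾ = R ∩ ⋂_{P ∈ Min(Q)} Qⁿ R_P` of an ideal `Q` of `R`: the
intersection, over the minimal primes `P` of `Q`, of the preimages in `R` of the extensions
`Qⁿ R_P` of `Qⁿ` to the localizations of `R` at `P`. -/
def symbolicPower {R : Type*} [CommRing R] (Q : Ideal R) (n : ℕ) : Ideal R :=
  ⨅ P : Q.minimalPrimes,
    haveI : P.1.IsPrime := Ideal.IsMinimalPrime.isPrime P.2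
    ((Q ^ n).map (algebraMap R (Localization.AtPrime P.1))).comap
      (algebraMap R (Localization.AtPrime P.1))

/-- `α(I) = min {d | I_d ≠ 0}`: the smallest degree of a nonzero homogeneous element of an ideal
`I` of a standard graded polynomial ring (meant for nonzero homogeneous ideals `I`). -/
def initialDegree {σ k : Type*} [Field k] (I : Ideal (MvPolynomial σ k)) : ℕ :=
  sInf {d : ℕ | ∃ f ∈ I, f.IsHomogeneous d ∧ f ≠ 0}

/-- The sequence `m ↦ α(I⁽ᵐ⁾) / m`, whose limit is the Waldschmidt constant of `I`
(its value at `m = 0` is irrelevant). -/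
def waldschmidtSeq {σ k : Type*} [Field k] (I : Ideal (MvPolynomial σ k)) (m : ℕ) : ℝ :=
  (initialDegree (symbolicPower I m) : ℝ) / (m : ℝ)

/-- The Waldschmidt constant `α̂(I) = lim_{m → ∞} α(I⁽ᵐ⁾) / m`. -/
def waldschmidtConstant {σ k : Type*} [Field k] (I : Ideal (MvPolynomial σ k)) : ℝ :=
  limUnder atTop (waldschmidtSeq I)

/-- For ideals `I` of `A = k[X]` and `J` of `B = k[Y]`, the ideal `I + J` of
`A ⊗_k B = k[X, Y]`: the sum of the extensions of `I` and `J` to the polynomial ring in the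
disjoint union of the two sets of variables. -/
def extendedSum {σ τ k : Type*} [Field k] (I : Ideal (MvPolynomial σ k))
    (J : Ideal (MvPolynomial τ k)) : Ideal (MvPolynomial (σ ⊕ τ) k) :=
  I.map (rename Sum.inl : MvPolynomial σ k →ₐ[k] MvPolynomial (σ ⊕ τ) k) +
    J.map (rename Sum.inr : MvPolynomial τ k →ₐ[k] MvPolynomial (σ ⊕ τ) k)

end

/-! Since `α(I⁽ᵐ⁾)` is subadditive in `m`, Fekete's lemma gives the limits and identifies each with
an infimum over `m ≥ 1`. The formula then rests on two comparisons in `A ⊗ B`.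

Upper bound: `I⁽ᵐ⁾` and `J⁽ᵐ⁾` lie in `(I + J)⁽ᵐ⁾`, because minimal primes of `I + J` contract to
minimal primes of `I` and of `J`.

Lower bound: `(I + J)⁽ⁱ⁺ʲ⁾ ≤ I⁽ⁱ⁾ + J⁽ʲ⁾` (`symbolicPower_tensorSum_le`). Over a field, sums of
extended ideals commute with finite intersections, so `I⁽ⁱ⁾` and `J⁽ʲ⁾` may be replaced by primary
components `𝔞` and `𝔟`. Noether normalization embeds `A/𝔞 ⊗ B/𝔟` in a finite power of a polynomial
ring over which it is integral. Hence it has no embedded primes, and its associated primes pull back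
to minimal primes of `I + J`, where membership is known. Finally, for a monomial `x^u y^v` of a form
`f` of degree `d` in `(I + J)⁽ⁿ⁺¹⁾`, a choice of `i` adapted to `|u|` yields `α(I⁽ⁱ⁾) + α(J⁽ⁿ⁻ⁱ⁾) ≤
d`; the shift by one disappears in the limit. -/

/-! ### Torsion-freeness and absence of embedded primes in tensor products -/

open TensorProduct in
/-- Over a field, tensor products of jointly injective finite families of linear maps are jointly
injective. -/
theorem TensorProduct.eq_zero_of_forall_map_eq_zero {k : Type*} [Field k] {ι κ : Type*}
    [Finite ι] [Finite κ] {M N : Type*} [AddCommGroup M] [Module k M] [AddCommGroup N] [Module k N]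
    {M' : ι → Type*} {N' : κ → Type*} [∀ i, AddCommGroup (M' i)] [∀ i, Module k (M' i)]
    [∀ j, AddCommGroup (N' j)] [∀ j, Module k (N' j)]
    (f : ∀ i, M →ₗ[k] M' i) (g : ∀ j, N →ₗ[k] N' j)
    (hf : ∀ m, (∀ i, f i m = 0) → m = 0) (hg : ∀ n, (∀ j, g j n = 0) → n = 0)
    (t : M ⊗[k] N) (ht : ∀ i j, TensorProduct.map (f i) (g j) t = 0) : t = 0 := by
  classical
  cases nonempty_fintype ι
  cases nonempty_fintype κ
  have hinj : Function.Injective (TensorProduct.map (LinearMap.pi f) (LinearMap.pi g)) := by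
    apply TensorProduct.map_injective_of_flat_flat
    · rw [injective_iff_map_eq_zero]
      exact fun m hm => hf m fun i => congrFun hm i
    · rw [injective_iff_map_eq_zero]
      exact fun m hm => hg m fun i => congrFun hm i
  -- Finiteness of the families makes an element of the tensor product of the products the sum of
  -- its components.
  have key : ∀ s : (∀ i, M' i) ⊗[k] (∀ j, N' j),
      s = ∑ i, ∑ j, TensorProduct.map (LinearMap.single k M' i) (LinearMap.single k N' j)
        (TensorProduct.map (LinearMap.proj i) (LinearMap.proj j) s) := by
    intro s
    induction s with
    | zero => simp
    | add x y hx hy =>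
      conv_lhs => rw [hx, hy]
      simp only [map_add, Finset.sum_add_distrib]
    | tmul x y =>
      simp only [TensorProduct.map_tmul, LinearMap.proj_apply, LinearMap.coe_single]
      simp_rw [← TensorProduct.tmul_sum, ← TensorProduct.sum_tmul]
      rw [Finset.univ_sum_single x, Finset.univ_sum_single y]
  apply hinj
  rw [map_zero, key (TensorProduct.map (LinearMap.pi f) (LinearMap.pi g) t)]
  refine Finset.sum_eq_zero fun i _ => Finset.sum_eq_zero fun j _ => ?_
  have : TensorProduct.map (LinearMap.proj i) (LinearMap.proj j)
      (TensorProduct.map (LinearMap.pi f) (LinearMap.pi g) t) = TensorProduct.map (f i) (g j) t := by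
    rw [← LinearMap.comp_apply, ← TensorProduct.map_comp]
    rfl
  rw [this, ht, map_zero]

/-- On a finite torsion-free module over a domain, finitely many functionals separate points. -/
theorem Module.exists_dual_separating {D M : Type*} [CommRing D] [IsDomain D] [AddCommGroup M]
    [Module D M] [Module.Finite D M] [Module.IsTorsionFree D M] :
    ∃ (n : ℕ) (φ : Fin n → M →ₗ[D] D), ∀ m, (∀ i, φ i m = 0) → m = 0 := by
  classical
  let K := FractionRing D
  let V := LocalizedModule (nonZeroDivisors D) M
  let ι : M →ₗ[D] V := LocalizedModule.mkLinearMap (nonZeroDivisors D) M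
  have hι : Function.Injective ι := by
    rw [injective_iff_map_eq_zero]
    intro m hm
    rw [IsLocalizedModule.eq_zero_iff (nonZeroDivisors D)] at hm
    obtain ⟨c, hc⟩ := hm
    exact (smul_eq_zero.mp hc).resolve_left (nonZeroDivisors.ne_zero c.2)
  have : Module.Finite K V := Module.Finite.of_isLocalizedModule (nonZeroDivisors D) ι
  let b := Module.finBasis K V
  -- Coordinates on the generic fibre `V` separate points of `M`; a common denominator `c` of the
  -- values on generators makes each of them `D`-valued.
  have key : ∀ i, ∃ φ : M →ₗ[D] D, ∃ c : D, c ≠ 0 ∧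
      ∀ m, algebraMap D K (φ m) = algebraMap D K c * b.coord i (ι m) := by
    intro i
    let ψ : M →ₗ[D] K := ((b.coord i).restrictScalars D).comp ι
    obtain ⟨s, hs⟩ := Module.Finite.fg_top (R := D) (M := M)
    obtain ⟨c, hc⟩ := IsLocalization.exist_integer_multiples (nonZeroDivisors D) s ψ
    have hr : ∀ m, (c.1 • ψ) m ∈ LinearMap.range (Algebra.linearMap D K) := by
      intro m
      have hm : m ∈ Submodule.span D (s : Set M) := hs ▸ Submodule.mem_top
      induction hm using Submodule.span_induction with
      | mem x hx =>
        obtain ⟨y, hy⟩ := hc x hx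
        exact ⟨y, hy⟩
      | zero => simp
      | add x y _ _ hx hy => rw [map_add]; exact add_mem hx hy
      | smul a x _ hx => rw [map_smul]; exact Submodule.smul_mem _ a hx
    let e := LinearEquiv.ofInjective (Algebra.linearMap D K) (IsFractionRing.injective D K)
    refine ⟨e.symm.toLinearMap.comp ((c.1 • ψ).codRestrict _ hr), c, nonZeroDivisors.ne_zero c.2, ?_⟩
    intro m
    have := e.apply_symm_apply ((c.1 • ψ).codRestrict _ hr m)
    have := congrArg Subtype.val this
    rw [← Algebra.smul_def]
    exact this
  choose φ c hc hφ using key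
  refine ⟨_, φ, fun m hm => hι ?_⟩
  rw [map_zero]
  refine b.ext_elem fun i => ?_
  have h := hφ i m
  rw [hm i, map_zero] at h
  rw [map_zero, Finsupp.zero_apply]
  exact (mul_eq_zero.mp h.symm).resolve_left
    ((map_ne_zero_iff _ (IsFractionRing.injective D K)).mpr (hc i))

open TensorProduct in
/-- Let `A`, `B` be finite torsion-free algebras over domains `D`, `E` containing a field `k`, such
that `D ⊗ E` is a domain. Then `A ⊗ B` is torsion-free over `D ⊗ E`. -/
theorem Algebra.TensorProduct.eq_zero_of_map_mul_eq_zero {k D E A B : Type*} [Field k]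
    [CommRing D] [CommRing E] [CommRing A] [CommRing B] [Algebra k D] [Algebra k E] [Algebra k A]
    [Algebra k B] [IsDomain D] [IsDomain E] [IsDomain (D ⊗[k] E)] (f : D →ₐ[k] A) (g : E →ₐ[k] B)
    (hf : f.Finite) (hg : g.Finite)
    (hf0 : ∀ d a, f d * a = 0 → d = 0 ∨ a = 0) (hg0 : ∀ e b, g e * b = 0 → e = 0 ∨ b = 0)
    (d : D ⊗[k] E) (u : A ⊗[k] B) (h : Algebra.TensorProduct.map f g d * u = 0) (hd : d ≠ 0) :
    u = 0 := by
  let := f.toRingHom.toAlgebra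
  let := g.toRingHom.toAlgebra
  have : IsScalarTower k D A := .of_algebraMap_eq fun x => (f.commutes x).symm
  have : IsScalarTower k E B := .of_algebraMap_eq fun x => (g.commutes x).symm
  have : Module.Finite D A := hf
  have : Module.Finite E B := hg
  have : Module.IsTorsionFree D A := .of_smul_eq_zero fun d a h => hf0 d a (by
    rwa [Algebra.smul_def] at h)
  have : Module.IsTorsionFree E B := .of_smul_eq_zero fun d a h => hg0 d a (by
    rwa [Algebra.smul_def] at h)
  obtain ⟨m, φ, hφ⟩ := Module.exists_dual_separating (D := D) (M := A)
  obtain ⟨n, ψ, hψ⟩ := Module.exists_dual_separating (D := E) (M := B)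
  refine _root_.TensorProduct.eq_zero_of_forall_map_eq_zero (fun i => (φ i).restrictScalars k)
    (fun j => (ψ j).restrictScalars k) hφ hψ u fun i j => ?_
  -- `φ i ⊗ ψ j` is linear over `D ⊗ E`, so it carries the relation to one in a domain.
  have key : ∀ (d : D ⊗[k] E) (u : A ⊗[k] B),
      _root_.TensorProduct.map ((φ i).restrictScalars k) ((ψ j).restrictScalars k)
        (Algebra.TensorProduct.map f g d * u) =
      d * _root_.TensorProduct.map ((φ i).restrictScalars k) ((ψ j).restrictScalars k) u := by
    intro d u
    induction d with
    | zero => simp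
    | add x y hx hy => rw [map_add, add_mul, map_add, hx, hy, add_mul]
    | tmul x y =>
      induction u with
      | zero => simp
      | add x y hx hy => rw [mul_add, map_add, hx, hy, map_add, mul_add]
      | tmul a b =>
        simp only [Algebra.TensorProduct.map_tmul, Algebra.TensorProduct.tmul_mul_tmul,
          _root_.TensorProduct.map_tmul, LinearMap.coe_restrictScalars]
        have h1 : φ i (f x * a) = x * φ i a := (φ i).map_smul x a
        have h2 : ψ j (g y * b) = y * ψ j b := (ψ j).map_smul y b
        rw [h1, h2]
  have := key d u
  rw [h, map_zero] at this
  exact (mul_eq_zero.mp this.symm).resolve_left hd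

/-- Noether normalization for an algebra all of whose zero divisors are nilpotent: the algebra is
torsion-free over the polynomial ring. -/
theorem exists_finite_algHom_torsionFree {k A : Type*} [Field k] [CommRing A] [Nontrivial A]
    [Algebra k A] [Algebra.FiniteType k A]
    (hA : ∀ x y : A, x * y = 0 → IsNilpotent x ∨ y = 0) :
    ∃ (n : ℕ) (f : MvPolynomial (Fin n) k →ₐ[k] A), f.Finite ∧
      ∀ d a, f d * a = 0 → d = 0 ∨ a = 0 := by
  obtain ⟨n, f, hf, hfin⟩ := exists_finite_inj_algHom_of_fg k A
  refine ⟨n, f, hfin, fun d a h => (hA _ _ h).imp_left fun ⟨m, hm⟩ => ?_⟩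
  rw [← map_pow, map_eq_zero_iff f hf] at hm
  exact IsReduced.eq_zero d ⟨m, hm⟩

open TensorProduct in
/-- Let `A`, `B` be finitely generated algebras over a field all of whose zero divisors are
nilpotent. Then `A ⊗ B` has no embedded primes. -/
theorem Algebra.TensorProduct.eq_of_le_annihilator {k A B : Type*} [Field k]
    [CommRing A] [CommRing B] [Algebra k A] [Algebra k B] [Algebra.FiniteType k A]
    [Algebra.FiniteType k B]
    (hA : ∀ x y : A, x * y = 0 → IsNilpotent x ∨ y = 0)
    (hB : ∀ x y : B, x * y = 0 → IsNilpotent x ∨ y = 0)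
    (P : Ideal (A ⊗[k] B)) [hP : P.IsPrime] (u : A ⊗[k] B) (hu : ∀ t, t ∈ P ↔ t * u = 0)
    (P' : Ideal (A ⊗[k] B)) [hP' : P'.IsPrime] (hle : P' ≤ P) : P' = P := by
  have hu0 : u ≠ 0 := fun h => hP.ne_top ((Ideal.eq_top_iff_one _).mpr ((hu 1).mpr (by simp [h])))
  have : Nontrivial A := by
    by_contra hn
    rw [not_nontrivial_iff_subsingleton] at hn
    exact hu0 (Subsingleton.elim _ _)
  have : Nontrivial B := by
    by_contra hn
    rw [not_nontrivial_iff_subsingleton] at hn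
    exact hu0 (Subsingleton.elim _ _)
  obtain ⟨m, f, hf, hf0⟩ := exists_finite_algHom_torsionFree (k := k) hA
  obtain ⟨n, g, hg, hg0⟩ := exists_finite_algHom_torsionFree (k := k) hB
  have : IsDomain (MvPolynomial (Fin m) k ⊗[k] MvPolynomial (Fin n) k) :=
    (MvPolynomial.tensorEquivSum k (Fin m) (Fin n) k).toRingEquiv.isDomain_iff.mpr inferInstance
  let F := Algebra.TensorProduct.map f g
  have hF : F.toRingHom.IsIntegral := by
    have := RingHom.Finite.tensorProductMap hf hg
    exact this.to_isIntegral
  let := F.toRingHom.toAlgebra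
  have : Algebra.IsIntegral (MvPolynomial (Fin m) k ⊗[k] MvPolynomial (Fin n) k) (A ⊗[k] B) :=
    ⟨hF⟩
  -- Elements of `P` kill `u ≠ 0`, so torsion-freeness leaves only zero in the contraction;
  -- incomparability for integral extensions then excludes a smaller prime.
  have hbot : P.comap F.toRingHom = ⊥ := by
    rw [eq_bot_iff]
    intro d hd
    by_contra hd0
    exact hu0 (Algebra.TensorProduct.eq_zero_of_map_mul_eq_zero f g hf hg hf0 hg0 d u
      ((hu _).mp hd) hd0)
  by_contra hne
  have := Ideal.IsIntegral.comap_lt_comap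
    (R := MvPolynomial (Fin m) k ⊗[k] MvPolynomial (Fin n) k) (lt_of_le_of_ne hle hne)
  exact not_lt_bot (hbot ▸ this)

open TensorProduct in
/-- Over a field, nonzerodivisors of `A` stay nonzerodivisors in `A ⊗ B`. -/
theorem Algebra.TensorProduct.eq_zero_of_tmul_one_mul {k A B : Type*} [Field k]
    [CommRing A] [CommRing B] [Algebra k A] [Algebra k B] (a : A) (ha : ∀ x, a * x = 0 → x = 0)
    (u : A ⊗[k] B) (h : (a ⊗ₜ[k] (1 : B)) * u = 0) : u = 0 := by
  have hinj : Function.Injective (LinearMap.rTensor B (LinearMap.mulLeft k a)) :=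
    Module.Flat.rTensor_preserves_injective_linearMap _
      ((injective_iff_map_eq_zero _).mpr ha)
  apply hinj
  rw [map_zero, ← h]
  clear h
  induction u with
  | zero => simp
  | add x y hx hy => rw [map_add, hx, hy, mul_add]
  | tmul x y => simp

open TensorProduct in
/-- Over a field, nonzerodivisors of `B` stay nonzerodivisors in `A ⊗ B`. -/
theorem Algebra.TensorProduct.eq_zero_of_one_tmul_mul {k A B : Type*} [Field k]
    [CommRing A] [CommRing B] [Algebra k A] [Algebra k B] (b : B) (hb : ∀ x, b * x = 0 → x = 0)
    (u : A ⊗[k] B) (h : ((1 : A) ⊗ₜ[k] b) * u = 0) : u = 0 := by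
  apply (Algebra.TensorProduct.comm k A B).injective
  rw [map_zero]
  refine Algebra.TensorProduct.eq_zero_of_tmul_one_mul b hb _ ?_
  rw [← map_zero (Algebra.TensorProduct.comm k A B), ← h, map_mul]
  simp

/-! ### Symbolic powers and localization at minimal primes -/

/-- Elements of the contraction of the extension of an ideal to the localization at a prime. -/
theorem Ideal.mem_comap_map_localizationAtPrime {R : Type*} [CommRing R] (I P : Ideal R)
    [P.IsPrime] (f : R) :
    f ∈ (I.map (algebraMap R (Localization.AtPrime P))).comap
      (algebraMap R (Localization.AtPrime P)) ↔ ∃ s ∉ P, s * f ∈ I := by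
  rw [Ideal.mem_comap, IsLocalization.algebraMap_mem_map_algebraMap_iff P.primeCompl]
  rfl

theorem mem_symbolicPower {R : Type*} [CommRing R] {Q : Ideal R} {n : ℕ} {f : R} :
    f ∈ symbolicPower Q n ↔ ∀ P ∈ Q.minimalPrimes, ∃ s ∉ P, s * f ∈ Q ^ n := by
  rw [symbolicPower, Ideal.mem_iInf, Subtype.forall]
  refine forall₂_congr fun P hP => ?_
  have : P.IsPrime := hP.isPrime
  exact Ideal.mem_comap_map_localizationAtPrime _ P f

theorem pow_le_symbolicPower {R : Type*} [CommRing R] (Q : Ideal R) (n : ℕ) :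
    Q ^ n ≤ symbolicPower Q n := fun f hf => mem_symbolicPower.mpr fun P hP =>
  ⟨1, (Ideal.ne_top_iff_one P).mp hP.isPrime.ne_top, by rwa [one_mul]⟩

theorem mul_mem_symbolicPower {R : Type*} [CommRing R] {Q : Ideal R} {m n : ℕ} {f g : R}
    (hf : f ∈ symbolicPower Q m) (hg : g ∈ symbolicPower Q n) :
    f * g ∈ symbolicPower Q (m + n) := by
  rw [mem_symbolicPower] at *
  intro P hP
  obtain ⟨s, hs, hsf⟩ := hf P hP
  obtain ⟨t, ht, htg⟩ := hg P hP
  refine ⟨s * t, fun h => (hP.isPrime.mem_or_mem h).elim hs ht, ?_⟩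
  rw [mul_mul_mul_comm, pow_add]
  exact Ideal.mul_mem_mul hsf htg

theorem map_mem_symbolicPower_of_equiv {R S F : Type*} [CommRing R] [CommRing S] [EquivLike F R S]
    [RingEquivClass F R S] (e : F) {Q : Ideal R} {n : ℕ} {f : R} (hf : f ∈ symbolicPower Q n) :
    e f ∈ symbolicPower (Q.map e) n := by
  rw [mem_symbolicPower] at *
  intro P hP
  have hP' : P.comap e ∈ Q.minimalPrimes := by
    have := Ideal.comap_minimalPrimes_eq_of_surjective (f := (e : R →+* S)) (EquivLike.surjective e) (Q.map e)
    have h2 : (Q.map e).comap (e : R →+* S) = Q := Ideal.comap_map_of_bijective e (EquivLike.bijective e)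
    rw [h2] at this
    rw [this]
    exact ⟨P, hP, rfl⟩
  obtain ⟨s, hs, hsf⟩ := hf _ hP'
  refine ⟨e s, hs, ?_⟩
  rw [← map_mul, ← Ideal.map_pow]
  exact Ideal.mem_map_of_mem _ hsf

/-- Powers of elements of a minimal prime of `I` lie in `I`, up to a factor outside the prime. -/
theorem Ideal.exists_mul_pow_mem_of_mem_minimalPrimes {R : Type*} [CommRing R] {I P : Ideal R}
    (hP : P ∈ I.minimalPrimes) {x : R} (hx : x ∈ P) : ∃ s ∉ P, ∃ n : ℕ, s * x ^ n ∈ I := by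
  have := hP.isPrime
  have h : algebraMap R (Localization.AtPrime P) x ∈
      (I.map (algebraMap R (Localization.AtPrime P))).radical := by
    rw [IsLocalization.AtPrime.radical_map_of_mem_minimalPrimes _ P I hP]
    exact Ideal.mem_map_of_mem _ hx
  obtain ⟨n, hn⟩ := h
  rw [← map_pow] at hn
  obtain ⟨s, hs, h⟩ := (Ideal.mem_comap_map_localizationAtPrime I P (x ^ n)).mp hn
  exact ⟨s, hs, n, h⟩

/-- The contraction of an extended ideal from the localization at `p` is primary to `p`. -/
theorem Ideal.mem_or_mem_comap_map_localizationAtPrime {R : Type*} [CommRing R] (I p : Ideal R)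
    [p.IsPrime] (x y : R)
    (hxy : x * y ∈ (I.map (algebraMap R (Localization.AtPrime p))).comap
      (algebraMap R (Localization.AtPrime p))) :
    x ∈ p ∨ y ∈ (I.map (algebraMap R (Localization.AtPrime p))).comap
      (algebraMap R (Localization.AtPrime p)) := by
  rw [Ideal.mem_comap_map_localizationAtPrime] at *
  obtain ⟨s, hs, hxy⟩ := hxy
  refine or_iff_not_imp_left.mpr fun hx => ⟨s * x, ?_, by rwa [mul_assoc]⟩
  exact fun h => (Ideal.IsPrime.mem_or_mem ‹_› h).elim hs hx

theorem Ideal.le_radical_comap_map_localizationAtPrime {R : Type*} [CommRing R] {I p : Ideal R}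
    [hp' : p.IsPrime] (hp : p ∈ I.minimalPrimes) (n : ℕ) :
    p ≤ (((I ^ n).map (algebraMap R (Localization.AtPrime p))).comap
      (algebraMap R (Localization.AtPrime p))).radical := by
  intro x hx
  obtain ⟨s, hs, m, h⟩ := Ideal.exists_mul_pow_mem_of_mem_minimalPrimes hp hx
  refine ⟨m * n, (Ideal.mem_comap_map_localizationAtPrime _ p _).mpr ⟨s ^ n, ?_, ?_⟩⟩
  · exact fun h => hs (hp'.mem_of_pow_mem n h)
  · rw [pow_mul, ← mul_pow]
    exact Ideal.pow_mem_pow h n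

/-! ### Symbolic powers of a sum of ideals in a tensor product -/

section TensorProduct

open TensorProduct

variable {k A B : Type*} [Field k] [CommRing A] [CommRing B] [Algebra k A] [Algebra k B]

/-- The ideal of `A ⊗ B` generated by an ideal of `A` and an ideal of `B`. -/
noncomputable def tensorSum (k : Type*) {A B : Type*} [Field k] [CommRing A] [CommRing B]
    [Algebra k A] [Algebra k B] (I : Ideal A) (J : Ideal B) : Ideal (A ⊗[k] B) :=
  I.map (Algebra.TensorProduct.includeLeft : A →ₐ[k] A ⊗[k] B) ⊔
    J.map (Algebra.TensorProduct.includeRight : B →ₐ[k] A ⊗[k] B)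

theorem tensorSum_le_iff {I : Ideal A} {J : Ideal B} {P : Ideal (A ⊗[k] B)} :
    tensorSum k I J ≤ P ↔ (∀ a ∈ I, a ⊗ₜ[k] (1 : B) ∈ P) ∧ ∀ b ∈ J, (1 : A) ⊗ₜ[k] b ∈ P := by
  rw [tensorSum, sup_le_iff, Ideal.map_le_iff_le_comap, Ideal.map_le_iff_le_comap]
  rfl

theorem tmul_one_mem_tensorSum {I : Ideal A} (J : Ideal B) {a : A} (ha : a ∈ I) :
    a ⊗ₜ[k] (1 : B) ∈ tensorSum k I J := (tensorSum_le_iff.mp le_rfl).1 a ha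

theorem one_tmul_mem_tensorSum (I : Ideal A) {J : Ideal B} {b : B} (hb : b ∈ J) :
    (1 : A) ⊗ₜ[k] b ∈ tensorSum k I J := (tensorSum_le_iff.mp le_rfl).2 b hb

theorem tensorSum_mono {I I' : Ideal A} {J J' : Ideal B} (hI : I ≤ I') (hJ : J ≤ J') :
    tensorSum k I J ≤ tensorSum k I' J' :=
  sup_le_sup (Ideal.map_mono hI) (Ideal.map_mono hJ)

theorem mem_tensorSum_iff (I : Ideal A) (J : Ideal B) (f : A ⊗[k] B) :
    f ∈ tensorSum k I J ↔
      Algebra.TensorProduct.map (Ideal.Quotient.mkₐ k I) (Ideal.Quotient.mkₐ k J) f = 0 := by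
  have := Algebra.TensorProduct.map_ker (Ideal.Quotient.mkₐ k I) (Ideal.Quotient.mkₐ k J)
    (Ideal.Quotient.mkₐ_surjective k I) (Ideal.Quotient.mkₐ_surjective k J)
  have hI : RingHom.ker (Ideal.Quotient.mkₐ k I) = I := Ideal.mk_ker
  have hJ : RingHom.ker (Ideal.Quotient.mkₐ k J) = J := Ideal.mk_ker
  rw [hI, hJ] at this
  rw [tensorSum, ← this, RingHom.mem_ker]

/-- If `f` lies locally at all minimal primes of `I + J` in the ideal `𝔞 + 𝔟`, where `𝔞` and `𝔟`
are primary to minimal primes of `I` and `J`, then `f` lies in `𝔞 + 𝔟`. -/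
theorem mem_tensorSum_of_forall_minimalPrimes [Algebra.FiniteType k A] [Algebra.FiniteType k B]
    {I p 𝔞 : Ideal A} {J q 𝔟 : Ideal B} (hp : p ∈ I.minimalPrimes) (hq : q ∈ J.minimalPrimes)
    (h𝔞 : ∀ x y, x * y ∈ 𝔞 → x ∈ p ∨ y ∈ 𝔞) (h𝔟 : ∀ x y, x * y ∈ 𝔟 → x ∈ q ∨ y ∈ 𝔟)
    (hp𝔞 : p ≤ 𝔞.radical) (hq𝔟 : q ≤ 𝔟.radical) {f : A ⊗[k] B}
    (hf : ∀ P ∈ (tensorSum k I J).minimalPrimes, ∃ s ∉ P, s * f ∈ tensorSum k 𝔞 𝔟) :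
    f ∈ tensorSum k 𝔞 𝔟 := by
  let π := Algebra.TensorProduct.map (Ideal.Quotient.mkₐ k 𝔞) (Ideal.Quotient.mkₐ k 𝔟)
  have hπs : Function.Surjective π :=
    TensorProduct.map_surjective (Ideal.Quotient.mkₐ_surjective k 𝔞)
      (Ideal.Quotient.mkₐ_surjective k 𝔟)
  have hπ : ∀ t, t ∈ tensorSum k 𝔞 𝔟 ↔ π t = 0 := mem_tensorSum_iff 𝔞 𝔟
  have hnil𝔞 : ∀ x ∈ p, IsNilpotent (Ideal.Quotient.mk 𝔞 x) := fun x hx => by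
    obtain ⟨n, hn⟩ := hp𝔞 hx
    exact ⟨n, by rw [← map_pow]; exact Ideal.Quotient.eq_zero_iff_mem.mpr hn⟩
  have hnil𝔟 : ∀ x ∈ q, IsNilpotent (Ideal.Quotient.mk 𝔟 x) := fun x hx => by
    obtain ⟨n, hn⟩ := hq𝔟 hx
    exact ⟨n, by rw [← map_pow]; exact Ideal.Quotient.eq_zero_iff_mem.mpr hn⟩
  have hA : ∀ x y : A ⧸ 𝔞, x * y = 0 → IsNilpotent x ∨ y = 0 := by
    intro x y hxy
    obtain ⟨x, rfl⟩ := Ideal.Quotient.mk_surjective x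
    obtain ⟨y, rfl⟩ := Ideal.Quotient.mk_surjective y
    rw [← map_mul, Ideal.Quotient.eq_zero_iff_mem] at hxy
    exact (h𝔞 x y hxy).imp (hnil𝔞 x) Ideal.Quotient.eq_zero_iff_mem.mpr
  have hB : ∀ x y : B ⧸ 𝔟, x * y = 0 → IsNilpotent x ∨ y = 0 := by
    intro x y hxy
    obtain ⟨x, rfl⟩ := Ideal.Quotient.mk_surjective x
    obtain ⟨y, rfl⟩ := Ideal.Quotient.mk_surjective y
    rw [← map_mul, Ideal.Quotient.eq_zero_iff_mem] at hxy
    exact (h𝔟 x y hxy).imp (hnil𝔟 x) Ideal.Quotient.eq_zero_iff_mem.mpr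
  rw [hπ]
  by_contra hf0
  have : Algebra.FiniteType k ((A ⧸ 𝔞) ⊗[k] (B ⧸ 𝔟)) :=
    Algebra.FiniteType.trans (S := A ⧸ 𝔞) inferInstance inferInstance
  have : IsNoetherianRing ((A ⧸ 𝔞) ⊗[k] (B ⧸ 𝔟)) := Algebra.FiniteType.isNoetherianRing k _
  -- `P` contains the annihilator of `π f` and is itself the annihilator of some `u`. Once `P` is
  -- known to pull back to a minimal prime of `I + J`, the multiplier `s` given by `hf` kills `π f`,
  -- yet lies outside `P`.
  obtain ⟨P, hP, hle⟩ := exists_le_isAssociatedPrime_of_isNoetherianRing ((A ⧸ 𝔞) ⊗[k] (B ⧸ 𝔟)) (π f) hf0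
  obtain ⟨hPprime, u, hPu⟩ := (isAssociatedPrime_iff (R := (A ⧸ 𝔞) ⊗[k] (B ⧸ 𝔟))).mp hP
  have hu : ∀ t, t ∈ P ↔ t * u = 0 := fun t => by
    rw [hPu, Submodule.mem_colon_singleton, Submodule.mem_bot, smul_eq_mul]
  have hu0 : u ≠ 0 := fun h =>
    hPprime.ne_top ((Ideal.eq_top_iff_one _).mpr ((hu 1).mpr (by simp [h])))
  -- Elements outside `p` are nonzerodivisors modulo `𝔞`, hence also on the tensor product, and
  -- cannot kill `u`.
  have hcontrA : ∀ a : A, π (a ⊗ₜ 1) ∈ P → a ∈ p := by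
    intro a ha
    by_contra hap
    refine hu0 (Algebra.TensorProduct.eq_zero_of_tmul_one_mul (Ideal.Quotient.mk 𝔞 a) ?_ u
      (by simpa [π] using (hu _).mp ha))
    intro x hx
    obtain ⟨x, rfl⟩ := Ideal.Quotient.mk_surjective x
    rw [← map_mul, Ideal.Quotient.eq_zero_iff_mem] at hx
    exact Ideal.Quotient.eq_zero_iff_mem.mpr ((h𝔞 a x hx).resolve_left hap)
  have hcontrB : ∀ b : B, π (1 ⊗ₜ b) ∈ P → b ∈ q := by
    intro b hb
    by_contra hbq
    refine hu0 (Algebra.TensorProduct.eq_zero_of_one_tmul_mul (Ideal.Quotient.mk 𝔟 b) ?_ u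
      (by simpa [π] using (hu _).mp hb))
    intro x hx
    obtain ⟨x, rfl⟩ := Ideal.Quotient.mk_surjective x
    rw [← map_mul, Ideal.Quotient.eq_zero_iff_mem] at hx
    exact Ideal.Quotient.eq_zero_iff_mem.mpr ((h𝔟 b x hx).resolve_left hbq)
  have hker : ∀ t, π t = 0 → π t ∈ P := fun t ht => ht ▸ P.zero_mem
  have hmin : P.comap π ∈ (tensorSum k I J).minimalPrimes := by
    refine ⟨⟨inferInstance, tensorSum_le_iff.mpr ⟨fun a ha => ?_, fun b hb => ?_⟩⟩, ?_⟩
    · obtain ⟨n, hn⟩ := hp𝔞 (hp.1.2 ha)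
      refine hPprime.mem_of_pow_mem n ?_
      rw [← map_pow, Algebra.TensorProduct.tmul_pow, one_pow]
      exact hker _ ((hπ _).mp (tmul_one_mem_tensorSum 𝔟 hn))
    · obtain ⟨n, hn⟩ := hq𝔟 (hq.1.2 hb)
      refine hPprime.mem_of_pow_mem n ?_
      rw [← map_pow, Algebra.TensorProduct.tmul_pow, one_pow]
      exact hker _ ((hπ _).mp (one_tmul_mem_tensorSum 𝔞 hn))
    · rintro P' ⟨hP', hIJ⟩ hP'P
      rw [tensorSum_le_iff] at hIJ
      have hpP' : p ≤ P'.comap (Algebra.TensorProduct.includeLeft : A →ₐ[k] A ⊗[k] B) :=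
        hp.2 ⟨inferInstance, fun a ha => hIJ.1 a ha⟩ fun a ha => hcontrA a (hP'P ha)
      have hqP' : q ≤ P'.comap (Algebra.TensorProduct.includeRight : B →ₐ[k] A ⊗[k] B) :=
        hq.2 ⟨inferInstance, fun b hb => hIJ.2 b hb⟩ fun b hb => hcontrB b (hP'P hb)
      -- As `P'` contains both `p` and `q`, it contains `𝔞` and `𝔟`, so it descends to the quotient,
      -- where there is no prime strictly below `P`.
      have hkerP' : RingHom.ker π ≤ P' := fun t ht =>
        tensorSum_le_iff.mpr
          ⟨fun a ha => hpP' (hcontrA a (hker _ ((hπ _).mp (tmul_one_mem_tensorSum 𝔟 ha)))),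
            fun b hb => hqP' (hcontrB b (hker _ ((hπ _).mp (one_tmul_mem_tensorSum 𝔞 hb))))⟩
          ((hπ t).mpr ht)
      have hP'' : (P'.map π).IsPrime := Ideal.map_isPrime_of_surjective hπs hkerP'
      have heq := Algebra.TensorProduct.eq_of_le_annihilator hA hB P u hu (P'.map π)
        (Ideal.map_le_iff_le_comap.mpr hP'P)
      rw [← heq, Ideal.comap_map_of_surjective' π hπs]
      exact sup_le le_rfl hkerP'
  obtain ⟨s, hs, hsf⟩ := hf _ hmin
  refine hs (hle ?_)
  rw [Submodule.mem_colon_singleton, Submodule.mem_bot, smul_eq_mul, ← map_mul]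
  exact (hπ _).mp hsf

/-- The quotient by a finite intersection embeds in the product of the quotients, and tensoring over
a field preserves this. -/
theorem mem_tensorSum_iInf {ι κ : Type*} [Finite ι] [Finite κ] {𝔞 : ι → Ideal A}
    {𝔟 : κ → Ideal B} {f : A ⊗[k] B} (hf : ∀ i j, f ∈ tensorSum k (𝔞 i) (𝔟 j)) :
    f ∈ tensorSum k (⨅ i, 𝔞 i) (⨅ j, 𝔟 j) := by
  rw [mem_tensorSum_iff]
  have h𝔞 : ∀ i, ⨅ i, 𝔞 i ≤ 𝔞 i := iInf_le _
  have h𝔟 : ∀ j, ⨅ j, 𝔟 j ≤ 𝔟 j := iInf_le _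
  refine _root_.TensorProduct.eq_zero_of_forall_map_eq_zero
    (fun i => (Ideal.Quotient.factorₐ k (h𝔞 i)).toLinearMap)
    (fun j => (Ideal.Quotient.factorₐ k (h𝔟 j)).toLinearMap) ?_ ?_ _ ?_
  · intro m hm
    obtain ⟨m, rfl⟩ := Ideal.Quotient.mk_surjective m
    rw [Ideal.Quotient.eq_zero_iff_mem, Ideal.mem_iInf]
    exact fun i => Ideal.Quotient.eq_zero_iff_mem.mp (hm i)
  · intro m hm
    obtain ⟨m, rfl⟩ := Ideal.Quotient.mk_surjective m
    rw [Ideal.Quotient.eq_zero_iff_mem, Ideal.mem_iInf]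
    exact fun i => Ideal.Quotient.eq_zero_iff_mem.mp (hm i)
  · intro i j
    rw [← (mem_tensorSum_iff _ _ _).mp (hf i j)]
    generalize f = f
    induction f with
    | zero => simp
    | add x y hx hy => simp only [map_add, hx, hy]
    | tmul x y => rfl

/-- `(I + J)^(i + j)` is contained in `I^(i) + J^(j)` for symbolic powers. -/
theorem symbolicPower_tensorSum_le [Algebra.FiniteType k A] [Algebra.FiniteType k B]
    (I : Ideal A) (J : Ideal B) (i j : ℕ) :
    symbolicPower (tensorSum k I J) (i + j) ≤
      tensorSum k (symbolicPower I i) (symbolicPower J j) := by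
  intro f hf
  have : IsNoetherianRing A := Algebra.FiniteType.isNoetherianRing k A
  have : IsNoetherianRing B := Algebra.FiniteType.isNoetherianRing k B
  have : Finite I.minimalPrimes := I.finite_minimalPrimes_of_isNoetherianRing
  have : Finite J.minimalPrimes := J.finite_minimalPrimes_of_isNoetherianRing
  refine mem_tensorSum_iInf (ι := I.minimalPrimes) (κ := J.minimalPrimes) fun p q => ?_
  have := p.2.isPrime
  have := q.2.isPrime
  refine mem_tensorSum_of_forall_minimalPrimes p.2 q.2
    (Ideal.mem_or_mem_comap_map_localizationAtPrime _ p.1)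
    (Ideal.mem_or_mem_comap_map_localizationAtPrime _ q.1)
    (Ideal.le_radical_comap_map_localizationAtPrime p.2 i)
    (Ideal.le_radical_comap_map_localizationAtPrime q.2 j) fun P hP => ?_
  obtain ⟨s, hs, hsf⟩ := mem_symbolicPower.mp hf P hP
  refine ⟨s, hs, ?_⟩
  -- In the expansion of `(I + J)^(i + j)`, each term has at least `i` factors from `I` or at least
  -- `j` from `J`.
  have h := Ideal.sup_pow_add_le_pow_sup_pow hsf
  rw [← Ideal.map_pow, ← Ideal.map_pow] at h
  exact tensorSum_mono Ideal.le_comap_map Ideal.le_comap_map h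

/-- Minimal primes of `I + J` contract to minimal primes of `I`. -/
theorem comap_includeLeft_mem_minimalPrimes {I : Ideal A} {J : Ideal B} {P : Ideal (A ⊗[k] B)}
    (hP : P ∈ (tensorSum k I J).minimalPrimes) :
    P.comap (Algebra.TensorProduct.includeLeft : A →ₐ[k] A ⊗[k] B) ∈ I.minimalPrimes := by
  have hPp := hP.isPrime
  have hIJ := tensorSum_le_iff.mp hP.1.2
  refine ⟨⟨inferInstance, fun a ha => hIJ.1 a ha⟩, ?_⟩
  rintro p ⟨hp, hIp⟩ hpP
  -- In `A/p ⊗ B/q`, which need not be a domain, the image of `P` is a minimal prime and so consists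
  -- of zero divisors. Nonzero elements of the domain `A/p` remain nonzerodivisors there, so `P`
  -- meets `A` only in `p`.
  let q := P.comap (Algebra.TensorProduct.includeRight : B →ₐ[k] A ⊗[k] B)
  let π := Algebra.TensorProduct.map (Ideal.Quotient.mkₐ k p) (Ideal.Quotient.mkₐ k q)
  have hπs : Function.Surjective π :=
    TensorProduct.map_surjective (Ideal.Quotient.mkₐ_surjective k p)
      (Ideal.Quotient.mkₐ_surjective k q)
  have hker : ∀ t, t ∈ tensorSum k p q ↔ π t = 0 := mem_tensorSum_iff p q
  have hkerP : RingHom.ker π ≤ P := fun t ht =>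
    tensorSum_le_iff.mpr ⟨fun a ha => hpP ha, fun b hb => hb⟩ ((hker t).mpr ht)
  have hmin : P.map π ∈ minimalPrimes ((A ⧸ p) ⊗[k] (B ⧸ q)) := by
    refine ⟨⟨Ideal.map_isPrime_of_surjective hπs hkerP, bot_le⟩, ?_⟩
    rintro P' ⟨hP', -⟩ hle
    have hzero : ∀ t, π t = 0 → t ∈ P'.comap π := fun t ht => by
      rw [Ideal.mem_comap, ht]; exact P'.zero_mem
    refine Ideal.map_le_iff_le_comap.mpr (hP.2 ⟨inferInstance, tensorSum_le_iff.mpr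
      ⟨fun a ha => hzero _ ((hker _).mp (tmul_one_mem_tensorSum q (hIp ha))),
        fun b hb => hzero _ ((hker _).mp (one_tmul_mem_tensorSum p (hIJ.2 b hb)))⟩⟩ ?_)
    refine (Ideal.comap_mono hle).trans ?_
    rw [Ideal.comap_map_of_surjective' π hπs]
    exact sup_le le_rfl hkerP
  intro a ha
  by_contra hap
  refine Set.disjoint_left.mp (Ideal.disjoint_nonZeroDivisors_of_mem_minimalPrimes hmin)
    (Ideal.mem_map_of_mem π ha) (mem_nonZeroDivisors_iff_left.mpr fun x hx => ?_)
  refine Algebra.TensorProduct.eq_zero_of_tmul_one_mul (Ideal.Quotient.mk p a)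
    (fun y hy => (mul_eq_zero.mp hy).resolve_left
      (mt Ideal.Quotient.eq_zero_iff_mem.mp hap)) x ?_
  simpa [π] using hx

theorem tmul_one_mem_symbolicPower {I : Ideal A} (J : Ideal B) {n : ℕ} {a : A}
    (ha : a ∈ symbolicPower I n) : a ⊗ₜ[k] (1 : B) ∈ symbolicPower (tensorSum k I J) n := by
  rw [mem_symbolicPower] at *
  intro P hP
  obtain ⟨s, hs, hsa⟩ := ha _ (comap_includeLeft_mem_minimalPrimes hP)
  refine ⟨s ⊗ₜ 1, hs, ?_⟩
  rw [Algebra.TensorProduct.tmul_mul_tmul, one_mul]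
  refine Ideal.pow_right_mono (le_sup_left (a := I.map Algebra.TensorProduct.includeLeft)) n ?_
  rw [← Ideal.map_pow]
  exact Ideal.mem_map_of_mem _ hsa

theorem map_comm_tensorSum (I : Ideal A) (J : Ideal B) :
    (tensorSum k I J).map (Algebra.TensorProduct.comm k A B) =
      tensorSum k J I := by
  change (tensorSum k I J).map (Algebra.TensorProduct.comm k A B).toAlgHom = _
  rw [tensorSum, tensorSum, Ideal.map_sup, sup_comm, Ideal.map_mapₐ, Ideal.map_mapₐ]
  congr 2

theorem one_tmul_mem_symbolicPower (I : Ideal A) {J : Ideal B} {n : ℕ} {b : B}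
    (hb : b ∈ symbolicPower J n) : (1 : A) ⊗ₜ[k] b ∈ symbolicPower (tensorSum k I J) n := by
  rw [← map_comm_tensorSum]
  exact map_mem_symbolicPower_of_equiv (Algebra.TensorProduct.comm k B A)
    (tmul_one_mem_symbolicPower I hb)

end TensorProduct

/-! ### Homogeneity of symbolic powers -/

/-- If a ring homomorphism kills all coefficients of `p * q` and sends some coefficient of `p` to a
unit, then it kills all coefficients of `q`. -/
theorem Polynomial.map_coeff_eq_zero_of_map_coeff_mul_eq_zero {A S : Type*} [CommRing A]
    [CommRing S] (ρ : A →+* S) {p q : Polynomial A} {b : ℕ} (hb : IsUnit (ρ (p.coeff b)))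
    (hpq : ∀ m, ρ ((p * q).coeff m) = 0) (n : ℕ) : ρ (q.coeff n) = 0 := by
  -- McCoy's theorem: a polynomial with a regular coefficient is regular.
  have hreg : p.map ρ ∈ nonZeroDivisors (Polynomial S) := by
    refine Polynomial.mem_nonzeroDivisors_of_coeff_mem b ?_
    rw [Polynomial.coeff_map]
    exact hb.mem_nonZeroDivisors
  have hzero : p.map ρ * q.map ρ = 0 := by
    rw [← Polynomial.map_mul]
    refine Polynomial.ext fun m => ?_
    rw [Polynomial.coeff_map, hpq m, Polynomial.coeff_zero]
  have hq := (mul_left_mem_nonZeroDivisors_eq_zero_iff hreg).mp hzero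
  rw [← Polynomial.coeff_map, hq, Polynomial.coeff_zero]

/-- If all coefficients of `p * q` lie in `Q` and some coefficient of `p` is not in the prime `P`,
then all coefficients of `q` lie in `Q` locally at `P`. -/
theorem Polynomial.exists_mul_coeff_mem_of_coeff_mul_mem {A : Type*} [CommRing A] {Q P : Ideal A}
    [P.IsPrime] {p q : Polynomial A} {b : ℕ} (hb : p.coeff b ∉ P)
    (hpq : ∀ m, (p * q).coeff m ∈ Q) (n : ℕ) : ∃ s ∉ P, s * q.coeff n ∈ Q := by
  refine (Ideal.mem_comap_map_localizationAtPrime Q P _).mp (Ideal.mem_comap.mpr ?_)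
  refine Ideal.Quotient.eq_zero_iff_mem.mp (Polynomial.map_coeff_eq_zero_of_map_coeff_mul_eq_zero
    ((Ideal.Quotient.mk (Q.map (algebraMap A (Localization.AtPrime P)))).comp
      (algebraMap A (Localization.AtPrime P))) (p := p) (b := b) ?_ (fun m => ?_) n)
  · exact (IsLocalization.map_units (Localization.AtPrime P) (⟨_, hb⟩ : P.primeCompl)).map
      (Ideal.Quotient.mk _)
  · exact Ideal.Quotient.eq_zero_iff_mem.mpr (Ideal.mem_map_of_mem _ (hpq m))

section Homogeneous

variable {σ k : Type*} [Field k]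

/-- The coefficients of `f(tX)`, as a polynomial in `t`, are the homogeneous components of `f`. -/
theorem MvPolynomial.coeff_aeval_C_X_mul_X (f : MvPolynomial σ k) (n : ℕ) :
    (aeval (fun i => Polynomial.C (X i : MvPolynomial σ k) * Polynomial.X) f).coeff n =
      homogeneousComponent n f := by
  induction f using MvPolynomial.induction_on' with
  | add p q hp hq => rw [map_add, Polynomial.coeff_add, hp, hq, map_add]
  | monomial d c =>
    rw [homogeneousComponent_of_mem (isHomogeneous_monomial c rfl), aeval_monomial]
    have : d.prod (fun i e => (Polynomial.C (X i : MvPolynomial σ k) * Polynomial.X) ^ e) =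
        Polynomial.C (monomial d (1 : k)) * Polynomial.X ^ d.degree := by
      simp_rw [mul_pow]
      rw [Finsupp.prod_mul, monomial_eq, map_mul, C_1, map_one, one_mul, Finsupp.prod, Finsupp.prod,
        Finsupp.prod, map_prod, Finset.prod_pow_eq_pow_sum]
      simp_rw [map_pow]
      rfl
    rw [this, Polynomial.algebraMap_apply, ← mul_assoc, ← map_mul, Polynomial.coeff_C_mul_X_pow,
      algebraMap_eq, C_mul_monomial, mul_one]

theorem Ideal.IsHomogeneous.homogeneousComponent_mem {I : Ideal (MvPolynomial σ k)}
    (hI : I.IsHomogeneous (homogeneousSubmodule σ k)) {f : MvPolynomial σ k} (hf : f ∈ I) (n : ℕ) :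
    homogeneousComponent n f ∈ I := by
  rw [← decomposition.decompose'_apply]
  exact hI n hf

theorem Ideal.IsHomogeneous.pow_homogeneousSubmodule {I : Ideal (MvPolynomial σ k)}
    (hI : I.IsHomogeneous (homogeneousSubmodule σ k)) (n : ℕ) :
    (I ^ n).IsHomogeneous (homogeneousSubmodule σ k) := by
  induction n with
  | zero => rw [pow_zero, Ideal.one_eq_top]; exact Ideal.IsHomogeneous.top _
  | succ n ih => rw [pow_succ]; exact ih.mul hI

/-- The contraction of a homogeneous ideal from the localization at any prime is homogeneous. -/
theorem Ideal.IsHomogeneous.exists_mul_homogeneousComponent_mem {Q : Ideal (MvPolynomial σ k)}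
    (hQ : Q.IsHomogeneous (homogeneousSubmodule σ k)) (P : Ideal (MvPolynomial σ k)) [P.IsPrime]
    {s f : MvPolynomial σ k} (hs : s ∉ P) (hsf : s * f ∈ Q) (n : ℕ) :
    ∃ s ∉ P, s * homogeneousComponent n f ∈ Q := by
  obtain ⟨b, hb⟩ : ∃ b, homogeneousComponent b s ∉ P := by
    by_contra! h
    apply hs
    rw [← sum_homogeneousComponent s]
    exact P.sum_mem fun i _ => h i
  -- Substituting `tX` turns components into coefficients in `t`, so `P` itself need not be
  -- homogeneous.
  rw [← coeff_aeval_C_X_mul_X] at hb ⊢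
  refine Polynomial.exists_mul_coeff_mem_of_coeff_mul_mem hb (fun m => ?_) n
  rw [← map_mul, coeff_aeval_C_X_mul_X]
  exact hQ.homogeneousComponent_mem hsf m

theorem homogeneousComponent_mem_symbolicPower {I : Ideal (MvPolynomial σ k)}
    (hI : I.IsHomogeneous (homogeneousSubmodule σ k)) {m : ℕ} {f : MvPolynomial σ k}
    (hf : f ∈ symbolicPower I m) (n : ℕ) : homogeneousComponent n f ∈ symbolicPower I m := by
  rw [mem_symbolicPower] at *
  intro P hP
  have := hP.isPrime
  obtain ⟨s, hs, hsf⟩ := hf P hP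
  exact (hI.pow_homogeneousSubmodule m).exists_mul_homogeneousComponent_mem P hs hsf n

end Homogeneous

/-! ### Initial degrees and existence of the Waldschmidt constants -/

section InitialDegree

variable {σ k : Type*} [Field k]

theorem initialDegree_le {I : Ideal (MvPolynomial σ k)} {f : MvPolynomial σ k} {d : ℕ}
    (hf : f ∈ I) (hd : f.IsHomogeneous d) (h0 : f ≠ 0) : initialDegree I ≤ d :=
  Nat.sInf_le ⟨f, hf, hd, h0⟩

theorem initialDegree_symbolicPower_zero (I : Ideal (MvPolynomial σ k)) :
    initialDegree (symbolicPower I 0) = 0 :=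
  Nat.le_zero.mp (initialDegree_le (pow_le_symbolicPower I 0 (by simp)) (isHomogeneous_one σ k)
    one_ne_zero)

/-- Powers of a nonzero form of `I` show that the infimum is attained and is not the default value
`0` of `sInf ∅`. -/
theorem exists_mem_symbolicPower_isHomogeneous_initialDegree {I : Ideal (MvPolynomial σ k)}
    (hI : ∃ d, ∃ f ∈ I, f.IsHomogeneous d ∧ f ≠ 0) (m : ℕ) :
    ∃ f ∈ symbolicPower I m, f.IsHomogeneous (initialDegree (symbolicPower I m)) ∧ f ≠ 0 := by
  refine Nat.sInf_mem (s := {d : ℕ | ∃ f ∈ symbolicPower I m, f.IsHomogeneous d ∧ f ≠ 0}) ?_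
  obtain ⟨d, f, hf, hd, h0⟩ := hI
  exact ⟨d * m, f ^ m, pow_le_symbolicPower I m (Ideal.pow_mem_pow hf m), hd.pow m,
    pow_ne_zero m h0⟩

theorem Ideal.IsHomogeneous.exists_isHomogeneous_ne_zero {I : Ideal (MvPolynomial σ k)}
    (hI : I.IsHomogeneous (homogeneousSubmodule σ k)) (hI0 : I ≠ ⊥) :
    ∃ d, ∃ f ∈ I, f.IsHomogeneous d ∧ f ≠ 0 := by
  obtain ⟨f, hf, hf0⟩ := Submodule.exists_mem_ne_zero_of_ne_bot hI0
  obtain ⟨d, hd⟩ : ∃ d, homogeneousComponent d f ≠ 0 := by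
    by_contra! h
    apply hf0
    rw [← sum_homogeneousComponent f]
    exact Finset.sum_eq_zero fun i _ => h i
  exact ⟨d, _, hI.homogeneousComponent_mem hf d, homogeneousComponent_isHomogeneous d f, hd⟩

theorem subadditive_initialDegree_symbolicPower {I : Ideal (MvPolynomial σ k)}
    (hI : ∃ d, ∃ f ∈ I, f.IsHomogeneous d ∧ f ≠ 0) :
    Subadditive fun m => (initialDegree (symbolicPower I m) : ℝ) := by
  intro m n
  beta_reduce
  obtain ⟨f, hf, hfd, hf0⟩ := exists_mem_symbolicPower_isHomogeneous_initialDegree hI m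
  obtain ⟨g, hg, hgd, hg0⟩ := exists_mem_symbolicPower_isHomogeneous_initialDegree hI n
  exact_mod_cast initialDegree_le (mul_mem_symbolicPower hf hg) (hfd.mul hgd) (mul_ne_zero hf0 hg0)

theorem bddBelow_range_waldschmidtSeq (I : Ideal (MvPolynomial σ k)) :
    BddBelow (Set.range fun m : ℕ => (initialDegree (symbolicPower I m) : ℝ) / m) :=
  ⟨0, by rintro _ ⟨m, rfl⟩; positivity⟩

theorem tendsto_waldschmidtSeq {I : Ideal (MvPolynomial σ k)}
    (hI : ∃ d, ∃ f ∈ I, f.IsHomogeneous d ∧ f ≠ 0) :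
    Tendsto (waldschmidtSeq I) atTop (𝓝 (waldschmidtConstant I)) :=
  tendsto_nhds_limUnder ⟨_, (subadditive_initialDegree_symbolicPower hI).tendsto_lim
    (bddBelow_range_waldschmidtSeq I)⟩

/-- By Fekete's lemma the limit is the infimum of the quotients with `m ≥ 1`. -/
theorem waldschmidtConstant_mul_le {I : Ideal (MvPolynomial σ k)}
    (hI : ∃ d, ∃ f ∈ I, f.IsHomogeneous d ∧ f ≠ 0) (m : ℕ) :
    waldschmidtConstant I * m ≤ initialDegree (symbolicPower I m) := by
  have h := subadditive_initialDegree_symbolicPower hI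
  have hlim : waldschmidtConstant I = h.lim :=
    tendsto_nhds_unique (tendsto_waldschmidtSeq hI)
      (h.tendsto_lim (bddBelow_range_waldschmidtSeq I))
  rcases Nat.eq_zero_or_pos m with rfl | hm
  · simp
  · rw [hlim, ← le_div_iff₀ (by exact_mod_cast hm)]
    exact h.lim_le_div (bddBelow_range_waldschmidtSeq I) hm.ne'

end InitialDegree

/-! ### Transfer to the joint polynomial ring and the degree count -/

section Sum

variable {σ τ k : Type*} [Field k]

open TensorProduct in
theorem extendedSum_eq_map_tensorEquivSum (I : Ideal (MvPolynomial σ k))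
    (J : Ideal (MvPolynomial τ k)) :
    extendedSum I J = (tensorSum k I J).map (tensorEquivSum k σ τ k) := by
  change _ = (tensorSum k I J).map (tensorEquivSum k σ τ k).toAlgHom
  rw [tensorSum, Ideal.map_sup, Ideal.map_mapₐ, Ideal.map_mapₐ, extendedSum, Submodule.add_eq_sup]
  congr 2
  · exact algHom_ext fun i => by simp
  · exact algHom_ext fun i => by simp

theorem tensorEquivSum_tmul_one (f : MvPolynomial σ k) :
    tensorEquivSum k σ τ k (f ⊗ₜ 1) = rename Sum.inl f := by
  have : (tensorEquivSum k σ τ k).toAlgHom.comp Algebra.TensorProduct.includeLeft =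
      rename Sum.inl := algHom_ext fun i => by simp
  exact DFunLike.congr_fun this f

theorem tensorEquivSum_one_tmul (f : MvPolynomial τ k) :
    tensorEquivSum k σ τ k (1 ⊗ₜ f) = rename Sum.inr f := by
  have : (tensorEquivSum k σ τ k).toAlgHom.comp Algebra.TensorProduct.includeRight =
      rename Sum.inr := algHom_ext fun i => by simp
  exact DFunLike.congr_fun this f

theorem rename_inl_mem_symbolicPower {I : Ideal (MvPolynomial σ k)} (J : Ideal (MvPolynomial τ k))
    {n : ℕ} {f : MvPolynomial σ k} (hf : f ∈ symbolicPower I n) :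
    rename Sum.inl f ∈ symbolicPower (extendedSum I J) n := by
  rw [extendedSum_eq_map_tensorEquivSum, ← tensorEquivSum_tmul_one]
  exact map_mem_symbolicPower_of_equiv _ (tmul_one_mem_symbolicPower J hf)

theorem rename_inr_mem_symbolicPower (I : Ideal (MvPolynomial σ k)) {J : Ideal (MvPolynomial τ k)}
    {n : ℕ} {f : MvPolynomial τ k} (hf : f ∈ symbolicPower J n) :
    rename Sum.inr f ∈ symbolicPower (extendedSum I J) n := by
  rw [extendedSum_eq_map_tensorEquivSum, ← tensorEquivSum_one_tmul]
  exact map_mem_symbolicPower_of_equiv _ (one_tmul_mem_symbolicPower I hf)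

theorem symbolicPower_extendedSum_le [Finite σ] [Finite τ] (I : Ideal (MvPolynomial σ k))
    (J : Ideal (MvPolynomial τ k)) (i j : ℕ) :
    symbolicPower (extendedSum I J) (i + j) ≤
      extendedSum (symbolicPower I i) (symbolicPower J j) := by
  intro f hf
  let e := tensorEquivSum k σ τ k
  have h := map_mem_symbolicPower_of_equiv e.symm hf
  have hmap : (extendedSum I J).map e.symm = tensorSum k I J := by
    rw [extendedSum_eq_map_tensorEquivSum]
    exact Ideal.map_of_equiv (I := tensorSum k I J) e.toRingEquiv
  rw [hmap] at h
  rw [extendedSum_eq_map_tensorEquivSum, ← e.apply_symm_apply f]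
  exact Ideal.mem_map_of_mem _ (symbolicPower_tensorSum_le I J i j h)

theorem coeff_coeff_sumAlgEquiv (f : MvPolynomial (σ ⊕ τ) k) (u : σ →₀ ℕ) (v : τ →₀ ℕ) :
    coeff v (coeff u (sumAlgEquiv k σ τ f)) = coeff (u.sumElim v) f := by
  classical
  induction f using MvPolynomial.induction_on' with
  | add p q hp hq => rw [map_add, coeff_add, coeff_add, coeff_add, hp, hq]
  | monomial w c =>
    obtain ⟨⟨u', v'⟩, rfl⟩ :=
      (Finsupp.sumFinsuppEquivProdFinsupp (α := σ) (β := τ) (γ := ℕ)).symm.surjective w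
    have h : sumAlgEquiv k σ τ (monomial (u'.sumElim v') c) = monomial u' (monomial v' c) := by
      simp [sumAlgEquiv, monomial]
    have hinj : u'.sumElim v' = u.sumElim v ↔ u' = u ∧ v' = v :=
      (Finsupp.sumFinsuppEquivProdFinsupp.symm.injective.eq_iff
        (a := (u', v')) (b := (u, v))).trans Prod.mk_inj
    change coeff v (coeff u (sumAlgEquiv k σ τ (monomial (u'.sumElim v') c))) =
      coeff (u.sumElim v) (monomial (u'.sumElim v') c)
    rw [h, coeff_monomial, coeff_monomial, if_congr hinj rfl rfl]
    split_ifs with h1 h2 h2 <;> simp_all [coeff_monomial]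

theorem coeff_sumAlgEquiv_mem_of_mem_map_rename_inr {V : Ideal (MvPolynomial τ k)}
    {f : MvPolynomial (σ ⊕ τ) k}
    (hf : f ∈ V.map (rename Sum.inr : MvPolynomial τ k →ₐ[k] MvPolynomial (σ ⊕ τ) k))
    (u : σ →₀ ℕ) : coeff u (sumAlgEquiv k σ τ f) ∈ V := by
  refine mem_map_C_iff.mp ?_ u
  have := Ideal.mem_map_of_mem (sumAlgEquiv k σ τ).toAlgHom hf
  rw [Ideal.map_mapₐ, sumAlgEquiv_comp_rename_inr] at this
  exact this

/-- If the elements of `U` have no terms in `x ^ u`, neither have those of its extension. -/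
theorem coeff_sumElim_eq_zero_of_mem_map_rename_inl {U : Ideal (MvPolynomial σ k)}
    {u : σ →₀ ℕ} (hU : ∀ g ∈ U, coeff u g = 0) {f : MvPolynomial (σ ⊕ τ) k}
    (hf : f ∈ U.map (rename Sum.inl : MvPolynomial σ k →ₐ[k] MvPolynomial (σ ⊕ τ) k))
    (v : τ →₀ ℕ) : coeff (u.sumElim v) f = 0 := by
  -- Swapping the two sets of variables reduces this to coefficients with respect to `y`, which lie
  -- in `U`.
  have h := Ideal.mem_map_of_mem
    (rename Sum.swap : MvPolynomial (σ ⊕ τ) k →ₐ[k] MvPolynomial (τ ⊕ σ) k) hf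
  have hswap : (rename Sum.swap : MvPolynomial (σ ⊕ τ) k →ₐ[k] MvPolynomial (τ ⊕ σ) k).comp
      (rename Sum.inl) = rename Sum.inr := algHom_ext fun i => by simp
  rw [Ideal.map_mapₐ, hswap] at h
  have := hU _ (coeff_sumAlgEquiv_mem_of_mem_map_rename_inr h v)
  rwa [coeff_coeff_sumAlgEquiv, ← Finsupp.mapDomain_swap_sumElim,
    coeff_rename_mapDomain _ Sum.swap_leftInverse.injective] at this

/-- For a monomial `x^u y^v` of `f`, the part `x^u` pays for `I⁽ⁱ⁾`. The coefficient of `x^u` in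
`f`, a nonzero form in `y` of degree `d - |u|`, pays for `J⁽ʲ⁾`. -/
theorem exists_initialDegree_add_initialDegree_le [Finite σ] [Finite τ]
    {I : Ideal (MvPolynomial σ k)} (hI : I.IsHomogeneous (homogeneousSubmodule σ k))
    (J : Ideal (MvPolynomial τ k)) {n d : ℕ} {f : MvPolynomial (σ ⊕ τ) k}
    (hf : f ∈ symbolicPower (extendedSum I J) (n + 1)) (hd : f.IsHomogeneous d) (hf0 : f ≠ 0) :
    ∃ i j, i + j = n ∧
      initialDegree (symbolicPower I i) + initialDegree (symbolicPower J j) ≤ d := by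
  obtain ⟨w, hw⟩ := ne_zero_iff.mp hf0
  obtain ⟨⟨u, v⟩, rfl⟩ := (Finsupp.sumFinsuppEquivProdFinsupp (α := σ) (β := τ) (γ := ℕ)).symm.surjective w
  change coeff (u.sumElim v) f ≠ 0 at hw
  have hdeg : ∀ v : τ →₀ ℕ, (u.sumElim v).degree = u.degree + v.degree := fun v => by
    rw [Finsupp.sumElim_eq_add, map_add, Finsupp.degree_mapDomain, Finsupp.degree_mapDomain]
  have hdeg_of_ne : ∀ v, coeff (u.sumElim v) f ≠ 0 → u.degree + v.degree = d := fun v hv => by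
    rw [← hdeg, Finsupp.degree_eq_weight_one]
    exact hd hv
  -- Maximality of `i` means that `x^u` has too low a degree to occur in `I⁽ⁱ⁺¹⁾`, unless `i = n`;
  -- then `j = 0` costs nothing.
  let i := Nat.findGreatest (fun i => initialDegree (symbolicPower I i) ≤ u.degree) n
  have hi : initialDegree (symbolicPower I i) ≤ u.degree :=
    Nat.findGreatest_spec (P := fun i => initialDegree (symbolicPower I i) ≤ u.degree) (Nat.zero_le n)
      (by rw [initialDegree_symbolicPower_zero]; exact Nat.zero_le _)
  have hin : i ≤ n := Nat.findGreatest_le n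
  refine ⟨i, n - i, by omega, ?_⟩
  rw [← hdeg_of_ne v hw]
  refine add_le_add hi ?_
  rcases hin.eq_or_lt with heq | hlt
  · rw [heq, Nat.sub_self, initialDegree_symbolicPower_zero]
    exact Nat.zero_le _
  have hi' : u.degree < initialDegree (symbolicPower I (i + 1)) :=
    not_le.mp (Nat.findGreatest_is_greatest
      (P := fun i => initialDegree (symbolicPower I i) ≤ u.degree) (Nat.lt_succ_self i) hlt)
  have hU : ∀ g ∈ symbolicPower I (i + 1), coeff u g = 0 := by
    intro g hg
    by_contra hne
    refine hi'.not_ge (initialDegree_le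
      (homogeneousComponent_mem_symbolicPower hI hg u.degree)
      (homogeneousComponent_isHomogeneous _ g) fun h0 => hne ?_)
    have := coeff_homogeneousComponent u.degree g u
    rwa [h0, coeff_zero, if_pos rfl, eq_comm] at this
  have hn : n + 1 = (i + 1) + (n - i) := by omega
  rw [hn] at hf
  obtain ⟨F, hF, G, hG, rfl⟩ := Submodule.mem_sup.mp (symbolicPower_extendedSum_le I J _ _ hf)
  -- The summand `F` from `I⁽ⁱ⁺¹⁾` has no term in `x^u`, so the coefficient of `x^u` in `f` is that
  -- of `G` and lies in `J⁽ⁿ⁻ⁱ⁾`.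
  have hcoeff : ∀ v, coeff v (coeff u (sumAlgEquiv k σ τ G)) = coeff (u.sumElim v) (F + G) :=
    fun v => by
      rw [coeff_coeff_sumAlgEquiv, coeff_add,
        coeff_sumElim_eq_zero_of_mem_map_rename_inl hU hF, zero_add]
  refine initialDegree_le (coeff_sumAlgEquiv_mem_of_mem_map_rename_inr hG u) ?_ ?_
  · intro v' hv'
    rw [hcoeff] at hv'
    have hwt : Finsupp.weight 1 v' = v'.degree :=
      (DFunLike.congr_fun (Finsupp.degree_eq_weight_one (R := ℕ)) v').symm
    have h1 := hdeg_of_ne v' hv'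
    have h2 := hdeg_of_ne v hw
    omega
  · intro h0
    apply hw
    rw [← hcoeff, h0, coeff_zero]

end Sum

/-! ### Comparison of the limits -/

theorem corollary3p9 {k : Type*} [Field k] {σ τ : Type*} [Finite σ] [Finite τ]
    (I : Ideal (MvPolynomial σ k)) (J : Ideal (MvPolynomial τ k))
    (hI : I.IsHomogeneous (homogeneousSubmodule σ k))
    (hJ : J.IsHomogeneous (homogeneousSubmodule τ k))
    (hI0 : I ≠ ⊥) (hI1 : I ≠ ⊤) (hJ0 : J ≠ ⊥) (hJ1 : J ≠ ⊤) :
    Tendsto (waldschmidtSeq I) atTop (𝓝 (waldschmidtConstant I)) ∧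
    Tendsto (waldschmidtSeq J) atTop (𝓝 (waldschmidtConstant J)) ∧
    Tendsto (waldschmidtSeq (extendedSum I J)) atTop
      (𝓝 (waldschmidtConstant (extendedSum I J))) ∧
    waldschmidtConstant (extendedSum I J) =
      min (waldschmidtConstant I) (waldschmidtConstant J) := by
  have hI' := hI.exists_isHomogeneous_ne_zero hI0
  have hJ' := hJ.exists_isHomogeneous_ne_zero hJ0
  have hQ' : ∃ d, ∃ f ∈ extendedSum I J, f.IsHomogeneous d ∧ f ≠ 0 := by
    obtain ⟨d, f, hf, hd, h0⟩ := hI'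
    exact ⟨d, rename Sum.inl f, Ideal.mem_sup_left (Ideal.mem_map_of_mem _ hf),
      hd.rename_isHomogeneous, (map_ne_zero_iff _ (rename_injective _ Sum.inl_injective)).mpr h0⟩
  have tI := tendsto_waldschmidtSeq hI'
  have tJ := tendsto_waldschmidtSeq hJ'
  have tQ := tendsto_waldschmidtSeq hQ'
  refine ⟨tI, tJ, tQ, le_antisymm (le_min ?_ ?_) ?_⟩
  · refine le_of_tendsto_of_tendsto' tQ tI fun m => ?_
    obtain ⟨f, hf, hd, h0⟩ := exists_mem_symbolicPower_isHomogeneous_initialDegree hI' m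
    refine div_le_div_of_nonneg_right ?_ (Nat.cast_nonneg m)
    exact_mod_cast initialDegree_le (rename_inl_mem_symbolicPower J hf) hd.rename_isHomogeneous
      ((map_ne_zero_iff _ (rename_injective _ Sum.inl_injective)).mpr h0)
  · refine le_of_tendsto_of_tendsto' tQ tJ fun m => ?_
    obtain ⟨f, hf, hd, h0⟩ := exists_mem_symbolicPower_isHomogeneous_initialDegree hJ' m
    refine div_le_div_of_nonneg_right ?_ (Nat.cast_nonneg m)
    exact_mod_cast initialDegree_le (rename_inr_mem_symbolicPower I hf) hd.rename_isHomogeneous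
      ((map_ne_zero_iff _ (rename_injective _ Sum.inr_injective)).mpr h0)
  · set c := min (waldschmidtConstant I) (waldschmidtConstant J)
    -- The degree count bounds the term of index `n + 1` below by `c * n / (n + 1)`, since only `i +
    -- j = n` is available.
    have hlim : Tendsto (fun n : ℕ => c * ((n : ℝ) / (n + 1))) atTop (𝓝 c) := by
      simpa using (tendsto_natCast_div_add_atTop (1 : ℝ)).const_mul c
    refine le_of_tendsto_of_tendsto' hlim (tQ.comp (tendsto_add_atTop_nat 1)) fun n => ?_
    obtain ⟨f, hf, hd, h0⟩ := exists_mem_symbolicPower_isHomogeneous_initialDegree hQ' (n + 1)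
    obtain ⟨i, j, hij, hle⟩ := exists_initialDegree_add_initialDegree_le hI J hf hd h0
    have hle' : (initialDegree (symbolicPower I i) : ℝ) + initialDegree (symbolicPower J j) ≤
        initialDegree (symbolicPower (extendedSum I J) (n + 1)) := by exact_mod_cast hle
    have h1 : c * i ≤ waldschmidtConstant I * i :=
      mul_le_mul_of_nonneg_right (min_le_left _ _) (Nat.cast_nonneg i)
    have h2 : c * j ≤ waldschmidtConstant J * j :=
      mul_le_mul_of_nonneg_right (min_le_right _ _) (Nat.cast_nonneg j)
    have h3 := waldschmidtConstant_mul_le hI' i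
    have h4 := waldschmidtConstant_mul_le hJ' j
    have hn : (n : ℝ) = i + j := by exact_mod_cast hij.symm
    rw [Function.comp_apply, waldschmidtSeq, mul_div_assoc', Nat.cast_add_one]
    refine div_le_div_of_nonneg_right ?_ (by positivity)
    rw [hn, mul_add]
    linarith
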